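/- **Setting.** $\|\cdot\|$ is the Euclidean norm of vectors and the spectral norm of matrices, and $n:=\max(N,T)$. Let $X=LF^\top+E$ with $L\in\mathbb R^{N\times r}$ deterministic, $F=[f_1,\dots,f_T]^\top\in\mathbb R^{T\times r}$ and $E\in\mathbb R^{N\times T}$ random, $r\ge 1$, and assume: * (Factors.) $F$ is independent of $E$; $\sup_{t\le T}\|f_t\|_{\psi_2}<\infty$; $\mathbb E f_tf_t^\top=I_r$ for all $t\le T$; and $\mathbb P\big(\|\frac1T\sum_{t=1}^T f_tf_t^\top-I_r\|\ge\delta_F\big)\le\eta_F$ with $\delta_F\le 1/2$. * (Loadings.) $L^\top L=\mathrm{diag}(\lambda_1^2,\dots,\lambda_r^2)$ with $\lambda_1\ge\dots\ge\lambda_r>0$. * (Separable Gaussian noise.) $\mathrm{vec}(E)\sim\mathcal N(0,\Sigma_C\otimes\Sigma_T)$ with $\Sigma_C\in\mathbb R^{N\times N}$, $\Sigma_T\in\mathbb R^{T\times T}$ symmetric positive definite, i.e. $E$ is a centred Gaussian matrix with $\mathrm{Cov}(E_{it},E_{js})=(\Sigma_C)_{ij}(\Sigma_T)_{ts}$. Let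 $Q\in\mathbb R^{T\times T}$ be a deterministic symmetric weight matrix with $\mathrm{rank}(Q)\ge r$. Let $(U,\Sigma,V)$ be the rank-$r$ SVD of $T^{-1/2}LF^\top$, let $\tilde U_Q\in\mathbb R^{N\times r}$ be the leading $r$ left singular vectors of $XQX^\top$, and let $(\hat U_Q,\hat\Sigma_Q,\hat V_Q)$ be the rank-$r$ truncated SVD of $T^{-1/2}\tilde U_Q\tilde U_Q^\top X$. Put $$\mathrm{Err}_V(Q):=\Big(\sqrt T+\sqrt n\,\|\hat U_Q\hat U_Q^\top-UU^\top\|\Big)\|\Sigma_T^{1/2}\|\,\|\Sigma_C^{1/2}\|+\lambda_1\sqrt T\,\|\hat U_Q\hat U_Q^\top-UU^\top\|.$$ **Theorem.** For all $A,c>0$ there are constants $c_0,C_0,C_1,C_2>0$, depending only on $A$ and $c$, such that for all $N,T,r$ and all models as above with $$T\le A\,e^{cN}\quad\text{and}\quad \log n\le A\,T,$$ there is an event of probability at least $1-\eta_F-C_2\big(e^{-c_0N}+n^{-9}\big)$ on which, for every choice of the above singular vectors, if $\lambda_r\sqrt T\ge C_0\,\mathrm{Err}_V(Q)$, then $$\|\hat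 V_Q\hat V_Q^\top-VV^\top\|\le C_1\,\frac{\mathrm{Err}_V(Q)}{\lambda_r\sqrt T}.$$ -/

import Mathlib

open MeasureTheory ProbabilityTheory
open scoped Matrix Kronecker ENNReal NNReal Matrix.Norms.L2Operator MatrixOrder

/-! Matrix norms below are spectral norms (the scope `Matrix.Norms.L2Operator` is open), and
`CFC.sqrt S` is the positive semidefinite square root of a positive semidefinite matrix `S`. -/

noncomputable section

namespace WPCA

/-- The Orlicz `ψ₂`-norm of a real random variable,
`inf {K > 0 : 𝔼 exp (Z² / K²) ≤ 2}` (equal to `∞` when there is no such `K`). -/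
def psi2Norm {Ω : Type*} [MeasurableSpace Ω] (μ : Measure Ω) (Z : Ω → ℝ) : ℝ≥0∞ :=
  ⨅ (K : ℝ≥0) (_ : 0 < K)
    (_ : ∫⁻ ω, ENNReal.ofReal (Real.exp ((Z ω / (K : ℝ)) ^ 2)) ∂μ ≤ 2), (K : ℝ≥0∞)

/-- The `ψ₂`-norm of a random vector: the supremum of the `ψ₂`-norms of its one-dimensional
marginals in unit directions. -/
def vecPsi2Norm {Ω : Type*} [MeasurableSpace Ω] (μ : Measure Ω) {r : ℕ}
    (f : Ω → Fin r → ℝ) : ℝ≥0∞ :=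
  ⨆ (x : Fin r → ℝ) (_ : x ⬝ᵥ x = 1), psi2Norm μ (fun ω => x ⬝ᵥ f ω)

/-- The factor model assumption.  The `t`-th factor `f_t` is the row `F ω t`; note that
`T⁻¹ ∑ₜ f_t f_tᵀ = T⁻¹ Fᵀ F` and that its expectation is the identity. -/
structure FactorAssumption {Ω : Type*} [MeasurableSpace Ω] (μ : Measure Ω) {N T r : ℕ}
    (L : Matrix (Fin N) (Fin r) ℝ) (lam : Fin r → ℝ)
    (F : Ω → Matrix (Fin T) (Fin r) ℝ) (E : Ω → Matrix (Fin N) (Fin T) ℝ)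
    (δ η : ℝ) : Prop where
  measurable_factor : ∀ t j, Measurable fun ω => F ω t j
  measurable_noise : ∀ i t, Measurable fun ω => E ω i t
  indep : IndepFun (fun ω (p : Fin T × Fin r) => F ω p.1 p.2)
    (fun ω (p : Fin N × Fin T) => E ω p.1 p.2) μ
  subgaussian : ⨆ t, vecPsi2Norm μ (fun ω => F ω t) < ∞
  second_moment : ∀ t j k, ∫ ω, F ω t j * F ω t k ∂μ = if j = k then 1 else 0
  concentration : μ.real {ω | δ ≤ ‖(T : ℝ)⁻¹ • ((F ω)ᵀ * F ω) - 1‖} ≤ η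
  loading : Lᵀ * L = Matrix.diagonal fun j => lam j ^ 2
  lam_antitone : Antitone lam
  lam_pos : ∀ j, 0 < lam j

/-- Separable Gaussian noise: `vec E ∼ N(0, S_C ⊗ S_T)`, i.e. `E` is a centred Gaussian matrix with
`Cov (E i t, E j s) = S_C i j * S_T t s`. -/
def SeparableGaussian {Ω : Type*} [MeasurableSpace Ω] (μ : Measure Ω) {N T : ℕ}
    (E : Ω → Matrix (Fin N) (Fin T) ℝ)
    (S_C : Matrix (Fin N) (Fin N) ℝ) (S_T : Matrix (Fin T) (Fin T) ℝ) : Prop :=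
  HasLaw (fun ω => WithLp.toLp 2 fun p : Fin N × Fin T => E ω p.1 p.2)
    (multivariateGaussian 0 (S_C ⊗ₖ S_T)) μ

/-- `(U, diag s, V)` is a rank-`r` truncated singular value decomposition of `A`: orthonormal
left and right singular vectors for `s₁ ≥ ⋯ ≥ s_r ≥ 0`, where no singular value of the remainder
exceeds `s_r`, so that the `s_i` are the `r` largest singular values. -/
structure IsTruncSVD {m n r : ℕ} (A : Matrix (Fin m) (Fin n) ℝ)
    (U : Matrix (Fin m) (Fin r) ℝ) (s : Fin r → ℝ) (V : Matrix (Fin n) (Fin r) ℝ) : Prop where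
  left_orthonormal : Uᵀ * U = 1
  right_orthonormal : Vᵀ * V = 1
  nonneg : ∀ i, 0 ≤ s i
  antitone : Antitone s
  mul_right : A * V = U * Matrix.diagonal s
  mul_left : Aᵀ * U = V * Matrix.diagonal s
  remainder_le : ∀ i, ‖A - U * Matrix.diagonal s * Vᵀ‖ ≤ s i

/-- The data matrix `X = L Fᵀ + E`. -/
def dataMatrix {N T r : ℕ} (L : Matrix (Fin N) (Fin r) ℝ) (F : Matrix (Fin T) (Fin r) ℝ)
    (E : Matrix (Fin N) (Fin T) ℝ) : Matrix (Fin N) (Fin T) ℝ :=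
  L * Fᵀ + E

/-- `(Uhat, diag s, Vhat)` is an output of weighted PCA on `X` with weight matrix `Q`: with
`Utilde` the leading `r` left singular vectors of `X Q Xᵀ`, it is a rank-`r` singular value
decomposition of `T^{-1/2} Utilde Utildeᵀ X`. -/
def IsWeightedPCA {N T r : ℕ} (X : Matrix (Fin N) (Fin T) ℝ) (Q : Matrix (Fin T) (Fin T) ℝ)
    (Uhat : Matrix (Fin N) (Fin r) ℝ) (s : Fin r → ℝ) (Vhat : Matrix (Fin T) (Fin r) ℝ) : Prop :=
  ∃ (Utilde : Matrix (Fin N) (Fin r) ℝ) (d : Fin r → ℝ) (W : Matrix (Fin N) (Fin r) ℝ),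
    IsTruncSVD (X * Q * Xᵀ) Utilde d W ∧
      IsTruncSVD ((√(T : ℝ))⁻¹ • (Utilde * Utildeᵀ * X)) Uhat s Vhat

/-- `Err_V`, where `lam₁` is the largest factor strength and `ξ` is the spectral-norm error of the
left subspace. -/
def errV {N T : ℕ} (lam₁ : ℝ) (S_C : Matrix (Fin N) (Fin N) ℝ) (S_T : Matrix (Fin T) (Fin T) ℝ)
    (ξ : ℝ) : ℝ :=
  (√(T : ℝ) + √(max N T : ℝ) * ξ) * ‖CFC.sqrt S_T‖ * ‖CFC.sqrt S_C‖ + lam₁ * √(T : ℝ) * ξ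

end WPCA

end

/-! On a good event the right subspaces are compared through two matrices of rank exactly `r`: `M =
T^{-1/2} L Fᵀ` and `M' = T^{-1/2} Uhat Uhatᵀ X`. The span of `U` is the range of `L`, so `U Uᵀ = Y
Yᵀ` with `Y` the normalized loadings, and `M' - M` splits into `(Uhat Uhatᵀ - U Uᵀ) M`, `T^{-1/2} U
Uᵀ E` and `T^{-1/2} (Uhat Uhatᵀ - U Uᵀ) E`. Since `U` is deterministic up to rotation, `‖U Uᵀ E‖ =
‖Yᵀ E‖` is of order `√T` and not `√n`, up to the noise scale; the other two terms carry the factor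
`‖Uhat Uhatᵀ - U Uᵀ‖`. Hence `√T ‖M' - M‖` is bounded by a constant times `errV`. Both matrices have
all `r` singular values of order at least `λ_r`, and Wedin's argument in each direction concludes
(`right_subspace_bound`).

Passing from `Utilde` to `Uhat` must not change the subspace. This could fail only if `Utildeᵀ X`
had rank below `r`, which `IsWeightedPCA.exact` excludes when `X` has full rank; that holds almost
surely because the Gaussian noise has a density, even conditionally on the factors
(`FactorAssumption.ae_full_rank`).

The bounds on `‖E‖` and `‖Yᵀ E‖` come from half-nets and scalar Gaussian tails
(`SeparableGaussian.measureReal_norm_gt_le`). -/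

namespace WPCA

/-! ### Orthonormal systems, truncated SVDs and subspace perturbation -/

section LinearAlgebra

variable {k m n r : ℕ}

lemma l2_opNorm_transpose (A : Matrix (Fin m) (Fin n) ℝ) : ‖Aᵀ‖ = ‖A‖ := by
  rw [← Matrix.conjTranspose_eq_transpose_of_trivial, Matrix.l2_opNorm_conjTranspose]

lemma l2_opNorm_transpose_mul_self (A : Matrix (Fin m) (Fin n) ℝ) : ‖Aᵀ * A‖ = ‖A‖ * ‖A‖ := by
  rw [← Matrix.conjTranspose_eq_transpose_of_trivial, Matrix.l2_opNorm_conjTranspose_mul_self]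

lemma l2_opNorm_one_le : ‖(1 : Matrix (Fin n) (Fin n) ℝ)‖ ≤ 1 := by
  have h := l2_opNorm_transpose_mul_self (1 : Matrix (Fin n) (Fin n) ℝ)
  rw [Matrix.transpose_one, one_mul] at h
  nlinarith [norm_nonneg (1 : Matrix (Fin n) (Fin n) ℝ)]

lemma l2_opNorm_le_one_of_orthonormal {U : Matrix (Fin m) (Fin n) ℝ} (hU : Uᵀ * U = 1) :
    ‖U‖ ≤ 1 := by
  have h := l2_opNorm_transpose_mul_self U
  rw [hU] at h
  nlinarith [l2_opNorm_one_le (n := n), norm_nonneg U]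

lemma l2_opNorm_orthonormal_mul {U : Matrix (Fin m) (Fin n) ℝ} (hU : Uᵀ * U = 1)
    (A : Matrix (Fin n) (Fin k) ℝ) : ‖U * A‖ = ‖A‖ := by
  have h := l2_opNorm_transpose_mul_self (U * A)
  rw [Matrix.transpose_mul, Matrix.mul_assoc, ← Matrix.mul_assoc Uᵀ, hU, Matrix.one_mul,
    l2_opNorm_transpose_mul_self] at h
  exact ((mul_self_inj (norm_nonneg _) (norm_nonneg _)).1 h).symm

lemma l2_opNorm_one_sub_proj_le {U : Matrix (Fin m) (Fin n) ℝ} (hU : Uᵀ * U = 1) :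
    ‖1 - U * Uᵀ‖ ≤ 1 := by
  have h := l2_opNorm_transpose_mul_self (1 - U * Uᵀ)
  have h2 : (1 - U * Uᵀ)ᵀ * (1 - U * Uᵀ) = 1 - U * Uᵀ := by
    have : U * Uᵀ * (U * Uᵀ) = U * Uᵀ := by
      rw [Matrix.mul_assoc, ← Matrix.mul_assoc Uᵀ, hU, Matrix.one_mul]
    simp [Matrix.sub_mul, Matrix.mul_sub, this]
  rw [h2] at h
  nlinarith [norm_nonneg (1 - U * Uᵀ)]

/-- Two orthonormal systems of the same size, one spanned by the other, span the same space. -/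
lemma proj_eq_of_eq_mul {U Y : Matrix (Fin m) (Fin r) ℝ} {Z : Matrix (Fin r) (Fin r) ℝ}
    (hU : Uᵀ * U = 1) (hY : Yᵀ * Y = 1) (h : U = Y * Z) : U * Uᵀ = Y * Yᵀ := by
  subst h
  have hZ : Zᵀ * Z = 1 := by
    rw [← hU, Matrix.transpose_mul, Matrix.mul_assoc, ← Matrix.mul_assoc Yᵀ, hY, Matrix.one_mul]
  rw [Matrix.transpose_mul, Matrix.mul_assoc, ← Matrix.mul_assoc Z, mul_eq_one_comm.1 hZ,
    Matrix.one_mul]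

lemma pos_of_diagonal_right_inverse {s : Fin r → ℝ} (hs : ∀ i, 0 ≤ s i)
    {P Q : Matrix (Fin r) (Fin r) ℝ} (h : P * Matrix.diagonal s * Q = 1) (i : Fin r) :
    0 < s i := by
  refine lt_of_le_of_ne (hs i) fun h0 => ?_
  have := congrArg Matrix.det h
  rw [Matrix.det_mul, Matrix.det_mul, Matrix.det_diagonal,
    Finset.prod_eq_zero (Finset.mem_univ i) h0.symm] at this
  simp at this

lemma diagonal_mul_diagonal_inv {s : Fin r → ℝ} (hs : ∀ i, 0 < s i) :
    Matrix.diagonal s * Matrix.diagonal (fun i => (s i)⁻¹) = 1 := by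
  rw [Matrix.diagonal_mul_diagonal, ← Matrix.diagonal_one]
  congr 1
  ext i
  exact mul_inv_cancel₀ (hs i).ne'

lemma l2_opNorm_diagonal_inv_le {s : Fin r → ℝ} {σ : ℝ} (hσ : 0 < σ) (hs : ∀ i, σ ≤ s i) :
    ‖Matrix.diagonal (fun i => (s i)⁻¹)‖ ≤ σ⁻¹ := by
  rw [Matrix.l2_opNorm_diagonal, pi_norm_le_iff_of_nonneg (inv_nonneg.2 hσ.le)]
  intro i
  rw [Real.norm_of_nonneg (inv_nonneg.2 (hσ.le.trans (hs i)))]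
  exact inv_anti₀ hσ (hs i)

namespace IsTruncSVD

variable {A : Matrix (Fin m) (Fin n) ℝ} {U : Matrix (Fin m) (Fin r) ℝ} {s : Fin r → ℝ}
  {V : Matrix (Fin n) (Fin r) ℝ}

lemma eq_of_eq_zero (h : IsTruncSVD A U s V) {i : Fin r} (hi : s i = 0) :
    A = U * Matrix.diagonal s * Vᵀ := by
  have := h.remainder_le i
  rw [hi] at this
  exact sub_eq_zero.1 (norm_le_zero_iff.1 this)

/-- The factorization forces rank at least `r`, while a vanishing `s i` makes the truncation exact
and so the rank smaller than `r`. -/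
lemma pos (h : IsTruncSVD A U s V) {B : Matrix (Fin r) (Fin m) ℝ} {W : Matrix (Fin n) (Fin r) ℝ}
    (hBW : B * A * W = 1) (i : Fin r) : 0 < s i := by
  refine lt_of_le_of_ne (h.nonneg i) fun h0 => ?_
  rw [h.eq_of_eq_zero h0.symm] at hBW
  have : (B * U) * Matrix.diagonal s * (Vᵀ * W) = 1 := by
    rw [← hBW]; simp only [Matrix.mul_assoc]
  exact (pos_of_diagonal_right_inverse h.nonneg this i).ne h0

lemma eq_mul (h : IsTruncSVD A U s V) (hs : ∀ i, 0 < s i) :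
    U = A * (V * Matrix.diagonal fun i => (s i)⁻¹) := by
  rw [← Matrix.mul_assoc, h.mul_right, Matrix.mul_assoc, diagonal_mul_diagonal_inv hs,
    Matrix.mul_one]

/-- If the range of `A` is spanned by the orthonormal columns of `Y`, then these span the same
space as the left singular vectors. -/
lemma proj_eq (h : IsTruncSVD A U s V) (hs : ∀ i, 0 < s i) {Y : Matrix (Fin m) (Fin r) ℝ}
    {Z : Matrix (Fin r) (Fin n) ℝ} (hY : Yᵀ * Y = 1) (hA : A = Y * Z) : U * Uᵀ = Y * Yᵀ := by
  have hU := h.eq_mul hs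
  rw [hA, Matrix.mul_assoc] at hU
  exact proj_eq_of_eq_mul h.left_orthonormal hY hU

lemma left_proj_mul (h : IsTruncSVD A U s V) :
    U * Uᵀ * A = U * Matrix.diagonal s * Vᵀ := by
  have h1 : Uᵀ * A = Matrix.diagonal s * Vᵀ := by
    rw [← Matrix.transpose_inj]
    simpa [Matrix.transpose_mul] using h.mul_left
  rw [Matrix.mul_assoc, h1, Matrix.mul_assoc]

/-- If `U` captures the whole range of `A`, the truncation has no remainder, so the rows of `A` lie
in the span of `V`. -/
lemma one_sub_proj_mul_transpose (h : IsTruncSVD A U s V) (hA : U * Uᵀ * A = A) :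
    (1 - V * Vᵀ) * Aᵀ = 0 := by
  have h1 : A = U * Matrix.diagonal s * Vᵀ := by rw [← h.left_proj_mul, hA]
  have h2 : Aᵀ = V * (Matrix.diagonal s * Uᵀ) := by
    conv_lhs => rw [h1]
    simp [Matrix.transpose_mul]
  rw [h2, ← Matrix.mul_assoc, Matrix.sub_mul, Matrix.one_mul, Matrix.mul_assoc V,
    h.right_orthonormal, Matrix.mul_one, sub_self, Matrix.zero_mul]

/-- One half of Wedin's theorem: a space containing the rows of `A'` almost contains the right
singular vectors of a matrix `A` close to `A'`. -/
lemma norm_one_sub_proj_mul_le (h : IsTruncSVD A U s V) {σ : ℝ} (hσ : 0 < σ)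
    (hs : ∀ i, σ ≤ s i) {A' : Matrix (Fin m) (Fin n) ℝ} {V' : Matrix (Fin n) (Fin r) ℝ}
    (hV' : V'ᵀ * V' = 1) (hA' : (1 - V' * V'ᵀ) * A'ᵀ = 0) :
    ‖(1 - V' * V'ᵀ) * (V * Vᵀ)‖ ≤ ‖A - A'‖ / σ := by
  -- Written this way, `V` starts with `Aᵀ`; since the projection kills `A'ᵀ`, only the difference
  -- `(A - A')ᵀ` survives.
  have hV : V = Aᵀ * U * Matrix.diagonal fun i => (s i)⁻¹ := by
    rw [h.mul_left, Matrix.mul_assoc, diagonal_mul_diagonal_inv fun i => hσ.trans_le (hs i),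
      Matrix.mul_one]
  have key : (1 - V' * V'ᵀ) * (V * Vᵀ) = (1 - V' * V'ᵀ) *
      ((A - A')ᵀ * (U * ((Matrix.diagonal fun i => (s i)⁻¹) * Vᵀ))) := by
    have e : (1 - V' * V'ᵀ) * (A - A')ᵀ = (1 - V' * V'ᵀ) * Aᵀ := by
      have : (A - A')ᵀ = Aᵀ - A'ᵀ := rfl
      rw [this, Matrix.mul_sub, hA', sub_zero]
    rw [← Matrix.mul_assoc _ (A - A')ᵀ, e]
    calc _ = (1 - V' * V'ᵀ) * ((Aᵀ * U * Matrix.diagonal fun i => (s i)⁻¹) * Vᵀ) := by rw [← hV]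
      _ = _ := by simp only [Matrix.mul_assoc]
  rw [key]
  have hU1 := l2_opNorm_le_one_of_orthonormal h.left_orthonormal
  have hV1 := l2_opNorm_le_one_of_orthonormal h.right_orthonormal
  rw [← l2_opNorm_transpose] at hV1
  calc _ ≤ 1 * (‖A - A'‖ * (1 * (σ⁻¹ * 1))) := by
        refine (Matrix.l2_opNorm_mul _ _).trans (mul_le_mul (l2_opNorm_one_sub_proj_le hV') ?_
          (norm_nonneg _) zero_le_one)
        refine (Matrix.l2_opNorm_mul _ _).trans (mul_le_mul (l2_opNorm_transpose _).le ?_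
          (norm_nonneg _) (norm_nonneg _))
        refine (Matrix.l2_opNorm_mul _ _).trans (mul_le_mul hU1 ?_ (norm_nonneg _) zero_le_one)
        exact (Matrix.l2_opNorm_mul _ _).trans (mul_le_mul (l2_opNorm_diagonal_inv_le hσ hs) hV1
          (norm_nonneg _) (inv_nonneg.2 hσ.le))
    _ = ‖A - A'‖ / σ := by ring

/-- Weyl-type lower bound for the singular values of a perturbation `A` of a matrix `M` whose
range is spanned by the orthonormal columns of `Y`. -/
lemma le_singularValue (h : IsTruncSVD A U s V) {Y : Matrix (Fin m) (Fin r) ℝ}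
    {M : Matrix (Fin m) (Fin n) ℝ} {σ : ℝ} (hσ : 0 ≤ σ) (hY : Yᵀ * Y = 1) (hM : Y * Yᵀ * M = M)
    (hlow : ∀ z : Matrix (Fin r) (Fin 1) ℝ, σ * ‖z‖ ≤ ‖Mᵀ * Y * z‖) (i : Fin r) :
    σ * (1 - ‖U * Uᵀ - Y * Yᵀ‖) - ‖A - M‖ ≤ s i := by
  -- The test vector is the `i`-th left singular vector `U * x`: `Aᵀ` maps it to length `s i`, and
  -- at most the projection gap of its unit length lies outside the span of `Y`.
  set x : Matrix (Fin r) (Fin 1) ℝ := Matrix.of fun j _ => if j = i then 1 else 0 with hx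
  have hxx : xᵀ * x = 1 := by
    ext a b
    simp [hx, Matrix.mul_apply, Matrix.one_apply, Subsingleton.elim a b]
  have hone : ‖(1 : Matrix (Fin 1) (Fin 1) ℝ)‖ = 1 := by
    rw [← Matrix.diagonal_one, Matrix.l2_opNorm_diagonal]
    simp
  have hxn : ‖x‖ = 1 := by
    have := l2_opNorm_orthonormal_mul hxx (1 : Matrix (Fin 1) (Fin 1) ℝ)
    rwa [Matrix.mul_one, hone] at this
  have hUx : ‖U * x‖ = 1 := by rw [l2_opNorm_orthonormal_mul h.left_orthonormal, hxn]
  have hsx : ‖Aᵀ * (U * x)‖ = s i := by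
    have : Matrix.diagonal s * x = s i • x := by
      ext a b
      by_cases hai : a = i <;> simp [hx, Matrix.diagonal_mul, hai]
    rw [← Matrix.mul_assoc, h.mul_left, Matrix.mul_assoc, this, Matrix.mul_smul, norm_smul,
      l2_opNorm_orthonormal_mul h.right_orthonormal, hxn, mul_one, Real.norm_of_nonneg (h.nonneg i)]
  have hMt : Mᵀ = Mᵀ * Y * Yᵀ := by
    conv_lhs => rw [← hM]
    simp [Matrix.transpose_mul, Matrix.mul_assoc]
  have h1 : σ * ‖Yᵀ * (U * x)‖ ≤ ‖Mᵀ * (U * x)‖ := by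
    conv_rhs => rw [hMt]
    rw [Matrix.mul_assoc (Mᵀ * Y)]
    exact hlow _
  have h2 : 1 - ‖U * Uᵀ - Y * Yᵀ‖ ≤ ‖Yᵀ * (U * x)‖ := by
    rw [← l2_opNorm_orthonormal_mul hY (Yᵀ * (U * x))]
    have e : U * x = (U * Uᵀ - Y * Yᵀ) * (U * x) + Y * (Yᵀ * (U * x)) := by
      rw [Matrix.sub_mul, Matrix.mul_assoc U, ← Matrix.mul_assoc Uᵀ, h.left_orthonormal,
        Matrix.one_mul, Matrix.mul_assoc Y]
      abel
    have e1 := norm_add_le ((U * Uᵀ - Y * Yᵀ) * (U * x)) (Y * (Yᵀ * (U * x)))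
    rw [← e, hUx] at e1
    have e2 := Matrix.l2_opNorm_mul (U * Uᵀ - Y * Yᵀ) (U * x)
    rw [hUx, mul_one] at e2
    linarith
  have h3 : ‖Mᵀ * (U * x)‖ ≤ s i + ‖A - M‖ := by
    have e : Mᵀ * (U * x) = Aᵀ * (U * x) - (A - M)ᵀ * (U * x) := by
      have : (A - M)ᵀ = Aᵀ - Mᵀ := rfl
      rw [this, Matrix.sub_mul]
      abel
    rw [e, ← hsx]
    refine (norm_sub_le _ _).trans (add_le_add le_rfl ((Matrix.l2_opNorm_mul _ _).trans ?_))
    rw [hUx, mul_one, l2_opNorm_transpose]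
  nlinarith [mul_le_mul_of_nonneg_left h2 hσ]

end IsTruncSVD

/-- For projections, `P' - P = P' (1 - P) - (1 - P') P`, and the first term is the transpose of `(1
- P) P'`. -/
lemma norm_proj_sub_proj_le (V V' : Matrix (Fin n) (Fin r) ℝ) :
    ‖V' * V'ᵀ - V * Vᵀ‖ ≤ ‖(1 - V' * V'ᵀ) * (V * Vᵀ)‖ + ‖(1 - V * Vᵀ) * (V' * V'ᵀ)‖ := by
  have e : V' * V'ᵀ - V * Vᵀ
      = (((1 - V * Vᵀ) * (V' * V'ᵀ)))ᵀ - (1 - V' * V'ᵀ) * (V * Vᵀ) := by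
    simp only [Matrix.transpose_mul, Matrix.transpose_sub,
      Matrix.transpose_transpose, Matrix.sub_mul, Matrix.one_mul]
    abel
  rw [e]
  refine (norm_sub_le _ _).trans ?_
  rw [l2_opNorm_transpose, add_comm]

/-- When the data matrix has full rank and the rank of the weight is at least `r`, the final
truncation in weighted PCA is exact. -/
lemma IsWeightedPCA.exact {N T : ℕ} {X : Matrix (Fin N) (Fin T) ℝ} {Q : Matrix (Fin T) (Fin T) ℝ}
    {Uhat : Matrix (Fin N) (Fin r) ℝ} {s : Fin r → ℝ} {Vhat : Matrix (Fin T) (Fin r) ℝ}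
    (h : IsWeightedPCA X Q Uhat s Vhat) (hT : 0 < T) (hQ : r ≤ Q.rank)
    (hX : (∃ W : Matrix (Fin T) (Fin N) ℝ, X * W = 1) ∨
      ∃ W : Matrix (Fin T) (Fin N) ℝ, W * X = 1) :
    IsTruncSVD ((√(T : ℝ))⁻¹ • (Uhat * Uhatᵀ * X)) Uhat s Vhat := by
  obtain ⟨Ut, d, W, h1, h2⟩ := h
  have hT' : (√(T : ℝ)) ≠ 0 := by positivity
  have hinv : ∃ Y : Matrix (Fin T) (Fin r) ℝ, Utᵀ * X * Y = 1 := by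
    -- A right inverse of `X` settles the rank of `Utildeᵀ X` whatever `Utilde` is. With only a left
    -- inverse, `X Q Xᵀ` has the rank of `Q`, so all `d i` are positive and the columns of `Utilde`
    -- lie in the range of `X`.
    rcases hX with ⟨Y, hY⟩ | ⟨Y, hY⟩
    · refine ⟨Y * Ut, ?_⟩
      rw [Matrix.mul_assoc, ← Matrix.mul_assoc X, hY, Matrix.one_mul, h1.left_orthonormal]
    · have hd : ∀ i, 0 < d i := by
        intro i
        refine lt_of_le_of_ne (h1.nonneg i) fun h0 => ?_
        have e := h1.eq_of_eq_zero h0.symm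
        have e2 : Q = (Y * Ut) * Matrix.diagonal d * (Wᵀ * Yᵀ) := by
          have hY' : Xᵀ * Yᵀ = 1 := by rw [← Matrix.transpose_mul, hY, Matrix.transpose_one]
          calc Q = (Y * X) * Q * (Xᵀ * Yᵀ) := by rw [hY, hY', Matrix.one_mul, Matrix.mul_one]
            _ = Y * (X * Q * Xᵀ) * Yᵀ := by simp only [Matrix.mul_assoc]
            _ = _ := by rw [e]; simp only [Matrix.mul_assoc]
        have hr1 : Q.rank ≤ (Matrix.diagonal d).rank := by
          rw [e2]
          exact (Matrix.rank_mul_le_left _ _).trans (Matrix.rank_mul_le_right _ _)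
        rw [Matrix.rank_diagonal] at hr1
        have hr2 : Fintype.card {j // d j ≠ 0} < Fintype.card (Fin r) :=
          Fintype.card_subtype_lt (x := i) (by simp [← h0])
        rw [Fintype.card_fin] at hr2
        omega
      have e := h1.eq_mul hd
      refine ⟨Q * Xᵀ * (W * Matrix.diagonal fun i => (d i)⁻¹), ?_⟩
      rw [← h1.left_orthonormal]
      conv_rhs => rhs; rw [e]
      simp only [Matrix.mul_assoc]
  obtain ⟨Y, hY⟩ := hinv
  have hs : ∀ i, 0 < s i := by
    refine h2.pos (B := Utᵀ) (W := √(T : ℝ) • Y) ?_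
    rw [Matrix.mul_smul, Matrix.mul_smul, Matrix.smul_mul, smul_smul, mul_inv_cancel₀ hT',
      one_smul, ← Matrix.mul_assoc Utᵀ, ← Matrix.mul_assoc Utᵀ, h1.left_orthonormal,
      Matrix.one_mul, hY]
  have hp : Uhat * Uhatᵀ = Ut * Utᵀ :=
    h2.proj_eq hs (Z := (√(T : ℝ))⁻¹ • (Utᵀ * X)) h1.left_orthonormal (by
      rw [Matrix.mul_smul, Matrix.mul_assoc])
  rwa [hp]

end LinearAlgebra


/-! ### The deterministic perturbation bound -/

section Deterministic

variable {N T r : ℕ}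

lemma isUnit_of_norm_sub_one_le_half {G : Matrix (Fin r) (Fin r) ℝ} (h : ‖G - 1‖ ≤ 1 / 2) :
    IsUnit G := by
  have h2 : ‖1 - G‖ < 1 := by
    rw [norm_sub_rev]
    linarith
  simpa using isUnit_one_sub_of_norm_lt_one h2

lemma norm_factor_sq (F : Matrix (Fin T) (Fin r) ℝ) {k : ℕ} (y : Matrix (Fin r) (Fin k) ℝ) :
    ‖((√(T : ℝ))⁻¹ • F) * y‖ ^ 2 = ‖yᵀ * ((T : ℝ)⁻¹ • (Fᵀ * F)) * y‖ := by
  rw [sq, ← l2_opNorm_transpose_mul_self]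
  congr 1
  rw [Matrix.smul_mul, Matrix.transpose_smul, Matrix.smul_mul, Matrix.mul_smul, smul_smul,
    ← mul_inv, Real.mul_self_sqrt (Nat.cast_nonneg T), Matrix.mul_smul, Matrix.smul_mul,
    Matrix.transpose_mul]
  simp only [Matrix.mul_assoc]

/-- The Gram matrix differs from the identity by at most `1/2`, so the squared norm drops at most to
`‖y‖² / 2`, which exceeds `(‖y‖ / 2)²`. -/
lemma norm_sq_half_le_norm_factor_sq {F : Matrix (Fin T) (Fin r) ℝ}
    (hF : ‖(T : ℝ)⁻¹ • (Fᵀ * F) - 1‖ ≤ 1 / 2) {k : ℕ} (y : Matrix (Fin r) (Fin k) ℝ) :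
    ‖y‖ / 2 ≤ ‖((√(T : ℝ))⁻¹ • F) * y‖ := by
  set G := (T : ℝ)⁻¹ • (Fᵀ * F) with hG
  have h1 := norm_factor_sq F y
  rw [← hG] at h1
  have e : yᵀ * y = yᵀ * G * y - yᵀ * (G - 1) * y := by
    rw [Matrix.mul_sub, Matrix.sub_mul, Matrix.mul_one]
    abel
  have h2 := norm_sub_le (yᵀ * G * y) (yᵀ * (G - 1) * y)
  rw [← e, l2_opNorm_transpose_mul_self, ← h1] at h2
  have h3 : ‖yᵀ * (G - 1) * y‖ ≤ ‖y‖ * (1 / 2) * ‖y‖ := by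
    refine (Matrix.l2_opNorm_mul _ _).trans (mul_le_mul_of_nonneg_right ?_ (norm_nonneg _))
    refine (Matrix.l2_opNorm_mul _ _).trans ?_
    rw [l2_opNorm_transpose]
    exact mul_le_mul_of_nonneg_left hF (norm_nonneg _)
  refine abs_le_of_sq_le_sq' ?_ (norm_nonneg _) |>.2
  nlinarith [sq_nonneg ‖y‖]

lemma norm_factor_le {F : Matrix (Fin T) (Fin r) ℝ}
    (hF : ‖(T : ℝ)⁻¹ • (Fᵀ * F) - 1‖ ≤ 1 / 2) : ‖(√(T : ℝ))⁻¹ • F‖ ≤ 2 := by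
  have h1 := norm_factor_sq F (1 : Matrix (Fin r) (Fin r) ℝ)
  rw [Matrix.mul_one, Matrix.mul_one, Matrix.transpose_one, Matrix.one_mul] at h1
  have h2 := norm_add_le ((T : ℝ)⁻¹ • (Fᵀ * F) - 1) 1
  rw [sub_add_cancel] at h2
  have h3 := l2_opNorm_one_le (n := r)
  nlinarith [norm_nonneg ((√(T : ℝ))⁻¹ • F)]

/-- The loadings with normalized columns. -/
noncomputable def normalizedLoading (L : Matrix (Fin N) (Fin r) ℝ) (lam : Fin r → ℝ) :
    Matrix (Fin N) (Fin r) ℝ :=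
  L * Matrix.diagonal fun j => (lam j)⁻¹

section Loading

variable {L : Matrix (Fin N) (Fin r) ℝ} {lam : Fin r → ℝ}

lemma normalizedLoading_orthonormal (hL : Lᵀ * L = Matrix.diagonal fun j => lam j ^ 2)
    (hlam : ∀ j, 0 < lam j) :
    (normalizedLoading L lam)ᵀ * normalizedLoading L lam = 1 := by
  rw [normalizedLoading, Matrix.transpose_mul, Matrix.diagonal_transpose, Matrix.mul_assoc,
    ← Matrix.mul_assoc Lᵀ, hL, Matrix.diagonal_mul_diagonal, Matrix.diagonal_mul_diagonal,
    ← Matrix.diagonal_one]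
  congr 1
  ext i
  have := (hlam i).ne'
  field_simp

lemma normalizedLoading_mul_diagonal (hlam : ∀ j, 0 < lam j) :
    normalizedLoading L lam * Matrix.diagonal lam = L := by
  rw [normalizedLoading, Matrix.mul_assoc, mul_eq_one_comm.1 (diagonal_mul_diagonal_inv hlam),
    Matrix.mul_one]

end Loading

set_option maxHeartbeats 800000 in
/-- The deterministic part of the theorem: a subspace perturbation bound for weighted PCA in terms
of the spectral norms of the noise and of its projection to the loading space. -/
theorem right_subspace_bound (hr : 0 < r) (hT : 0 < T) {L : Matrix (Fin N) (Fin r) ℝ}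
    {lam : Fin r → ℝ} {F : Matrix (Fin T) (Fin r) ℝ} {E : Matrix (Fin N) (Fin T) ℝ}
    {S_C : Matrix (Fin N) (Fin N) ℝ} {S_T Q : Matrix (Fin T) (Fin T) ℝ}
    (hL : Lᵀ * L = Matrix.diagonal fun j => lam j ^ 2) (hanti : Antitone lam)
    (hlam : ∀ j, 0 < lam j) (hF : ‖(T : ℝ)⁻¹ • (Fᵀ * F) - 1‖ ≤ 1 / 2) {K : ℝ} (hK : 0 ≤ K)
    (hE : ‖E‖ ≤ K * √(max N T : ℝ) * (‖CFC.sqrt S_T‖ * ‖CFC.sqrt S_C‖))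
    (hLE : ‖(normalizedLoading L lam)ᵀ * E‖ ≤ K * √(T : ℝ) * (‖CFC.sqrt S_T‖ * ‖CFC.sqrt S_C‖))
    (hQ : r ≤ Q.rank)
    (hX : (∃ W : Matrix (Fin T) (Fin N) ℝ, dataMatrix L F E * W = 1) ∨
      ∃ W : Matrix (Fin T) (Fin N) ℝ, W * dataMatrix L F E = 1)
    {U : Matrix (Fin N) (Fin r) ℝ} {s : Fin r → ℝ} {V : Matrix (Fin T) (Fin r) ℝ}
    {Uhat : Matrix (Fin N) (Fin r) ℝ} {shat : Fin r → ℝ} {Vhat : Matrix (Fin T) (Fin r) ℝ}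
    (h : IsTruncSVD ((√(T : ℝ))⁻¹ • (L * Fᵀ)) U s V)
    (hhat : IsWeightedPCA (dataMatrix L F E) Q Uhat shat Vhat)
    (herr : 8 * (4 + K) * errV (lam ⟨0, hr⟩) S_C S_T ‖Uhat * Uhatᵀ - U * Uᵀ‖
      ≤ lam ⟨r - 1, Nat.sub_lt hr one_pos⟩ * √(T : ℝ)) :
    ‖Vhat * Vhatᵀ - V * Vᵀ‖
      ≤ 12 * (4 + K) * (errV (lam ⟨0, hr⟩) S_C S_T ‖Uhat * Uhatᵀ - U * Uᵀ‖
        / (lam ⟨r - 1, Nat.sub_lt hr one_pos⟩ * √(T : ℝ))) := by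
  set ξ := ‖Uhat * Uhatᵀ - U * Uᵀ‖ with hξ
  set κ := ‖CFC.sqrt S_T‖ * ‖CFC.sqrt S_C‖ with hκ
  set l1 := lam ⟨0, hr⟩ with hl1
  set lr := lam ⟨r - 1, Nat.sub_lt hr one_pos⟩ with hlr
  set Y := normalizedLoading L lam with hYdef
  set M := (√(T : ℝ))⁻¹ • (L * Fᵀ) with hM
  set X := dataMatrix L F E with hXdef
  set w := √(T : ℝ) with hw
  have hw0 : 0 < w := Real.sqrt_pos.2 (by exact_mod_cast hT)
  have hξ0 : 0 ≤ ξ := norm_nonneg _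
  have hκ0 : 0 ≤ κ := by positivity
  have hl1r : lr ≤ l1 := hanti (Fin.mk_le_mk.2 (Nat.zero_le _))
  have hlr0 : 0 < lr := hlam _
  have hlr_le : ∀ i, lr ≤ lam i := fun i => hanti (Fin.mk_le_mk.2 (by omega))
  have hle_l1 : ∀ i, lam i ≤ l1 := fun i => hanti (Fin.mk_le_mk.2 (by omega))
  have hY : Yᵀ * Y = 1 := normalizedLoading_orthonormal hL hlam
  have hYL : Y * Matrix.diagonal lam = L := normalizedLoading_mul_diagonal hlam
  have hMY : M = Y * (Matrix.diagonal lam * (w⁻¹ • F)ᵀ) := by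
    rw [← Matrix.mul_assoc, hYL, hM, Matrix.transpose_smul, Matrix.mul_smul]
  have hYM : Yᵀ * M = Matrix.diagonal lam * (w⁻¹ • F)ᵀ := by
    rw [hMY, ← Matrix.mul_assoc, hY, Matrix.one_mul]
  have hlow : ∀ z : Matrix (Fin r) (Fin 1) ℝ, lr / 2 * ‖z‖ ≤ ‖Mᵀ * Y * z‖ := by
    intro z
    have e : Mᵀ * Y * z = (w⁻¹ • F) * (Matrix.diagonal lam * z) := by
      have := congrArg Matrix.transpose hYM
      rw [Matrix.transpose_mul, Matrix.transpose_transpose, Matrix.transpose_mul,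
        Matrix.transpose_transpose, Matrix.diagonal_transpose] at this
      rw [this, Matrix.mul_assoc]
    rw [e]
    refine le_trans ?_ (norm_sq_half_le_norm_factor_sq hF _)
    have h1 : z = (Matrix.diagonal fun i => (lam i)⁻¹) * (Matrix.diagonal lam * z) := by
      rw [← Matrix.mul_assoc, mul_eq_one_comm.1 (diagonal_mul_diagonal_inv hlam), Matrix.one_mul]
    have h2 : ‖z‖ ≤ lr⁻¹ * ‖Matrix.diagonal lam * z‖ := by
      conv_lhs => rw [h1]
      exact (Matrix.l2_opNorm_mul _ _).trans (mul_le_mul_of_nonneg_right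
        (l2_opNorm_diagonal_inv_le hlr0 hlr_le) (norm_nonneg _))
    rw [inv_mul_eq_div, le_div_iff₀ hlr0] at h2
    linarith
  have hs_pos : ∀ i, 0 < s i := by
    obtain ⟨G, hG⟩ := (isUnit_of_norm_sub_one_le_half hF)
    have hGG : (w⁻¹ • F)ᵀ * ((w⁻¹ • F) * (↑G⁻¹ : Matrix (Fin r) (Fin r) ℝ)) = 1 := by
      rw [← Matrix.mul_assoc, Matrix.transpose_smul, Matrix.smul_mul, Matrix.mul_smul, smul_smul,
        ← mul_inv, Real.mul_self_sqrt (Nat.cast_nonneg T), ← hG, Units.mul_inv]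
    refine h.pos (B := (Matrix.diagonal fun i => (lam i)⁻¹) * Yᵀ)
      (W := (w⁻¹ • F) * (↑G⁻¹ : Matrix (Fin r) (Fin r) ℝ)) ?_
    rw [Matrix.mul_assoc (Matrix.diagonal _), hYM, ← Matrix.mul_assoc (Matrix.diagonal _),
      mul_eq_one_comm.1 (diagonal_mul_diagonal_inv hlam), Matrix.one_mul, hGG]
  have hUY : U * Uᵀ = Y * Yᵀ := h.proj_eq hs_pos hY hMY
  have hYYM : Y * Yᵀ * M = M := by rw [Matrix.mul_assoc, hYM, ← hMY]
  have hUUM : U * Uᵀ * M = M := by rw [hUY, hYYM]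
  have hs_low : ∀ i, lr / 2 ≤ s i := by
    intro i
    -- The Weyl-type bound with `M` itself in place of the perturbation: both error terms vanish.
    have := h.le_singularValue (by positivity) hY hYYM hlow i
    rwa [hUY, sub_self, norm_zero, sub_self, norm_zero, sub_zero, sub_zero, mul_one] at this
  have hex := hhat.exact hT hQ hX
  set M' := w⁻¹ • (Uhat * Uhatᵀ * X) with hM'
  have hUUM' : Uhat * Uhatᵀ * M' = M' := by
    rw [hM', Matrix.mul_smul, ← Matrix.mul_assoc, Matrix.mul_assoc Uhat,
      ← Matrix.mul_assoc Uhatᵀ, hhat.choose_spec.choose_spec.choose_spec.2.left_orthonormal,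
      Matrix.one_mul]
  have hMnorm : ‖M‖ ≤ 2 * l1 := by
    rw [hMY, l2_opNorm_orthonormal_mul hY]
    refine (Matrix.l2_opNorm_mul _ _).trans ?_
    rw [l2_opNorm_transpose, mul_comm]
    refine mul_le_mul (norm_factor_le hF) ?_ (norm_nonneg _) zero_le_two
    rw [Matrix.l2_opNorm_diagonal, pi_norm_le_iff_of_nonneg (hlam _).le]
    intro i
    rw [Real.norm_of_nonneg (hlam i).le]
    exact hle_l1 i
  set err := errV l1 S_C S_T ξ with herr_def
  have herr_eq : err = (w + √(max N T : ℝ) * ξ) * κ + l1 * w * ξ := by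
    rw [herr_def, errV, hκ, mul_assoc _ ‖CFC.sqrt S_T‖]
  have hdiff : w * ‖M' - M‖ ≤ (4 + K) * err := by
    have e : M' - M = (Uhat * Uhatᵀ - U * Uᵀ) * M
        + w⁻¹ • (U * Uᵀ * E + (Uhat * Uhatᵀ - U * Uᵀ) * E) := by
      rw [Matrix.sub_mul, Matrix.sub_mul, hUUM, hM', hXdef, dataMatrix, Matrix.mul_add, hM,
        Matrix.mul_smul]
      simp only [smul_add, smul_sub]
      abel
    have h1 : ‖(Uhat * Uhatᵀ - U * Uᵀ) * M‖ ≤ ξ * (2 * l1) :=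
      (Matrix.l2_opNorm_mul _ _).trans (mul_le_mul_of_nonneg_left hMnorm hξ0)
    have h2 : ‖U * Uᵀ * E‖ ≤ K * w * κ := by
      rw [hUY, Matrix.mul_assoc, l2_opNorm_orthonormal_mul hY]
      exact hLE
    have h3 : ‖(Uhat * Uhatᵀ - U * Uᵀ) * E‖ ≤ ξ * (K * √(max N T : ℝ) * κ) :=
      (Matrix.l2_opNorm_mul _ _).trans (mul_le_mul_of_nonneg_left hE hξ0)
    have h4 : ‖M' - M‖ ≤ ξ * (2 * l1) + w⁻¹ * (K * w * κ + ξ * (K * √(max N T : ℝ) * κ)) := by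
      rw [e]
      refine (norm_add_le _ _).trans (add_le_add h1 ?_)
      rw [norm_smul, Real.norm_of_nonneg (inv_nonneg.2 hw0.le)]
      exact mul_le_mul_of_nonneg_left ((norm_add_le _ _).trans (add_le_add h2 h3))
        (inv_nonneg.2 hw0.le)
    have h5 := mul_le_mul_of_nonneg_left h4 hw0.le
    rw [mul_add, mul_inv_cancel_left₀ hw0.ne'] at h5
    refine h5.trans ?_
    rw [herr_eq]
    have p1 : 0 ≤ w * κ := by positivity
    have p2 : 0 ≤ √(max N T : ℝ) * ξ * κ := by positivity
    have p3 : 0 ≤ l1 * w * ξ := mul_nonneg (mul_nonneg (hlr0.le.trans hl1r) hw0.le) hξ0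
    have e1 : ξ * (K * √(max N T : ℝ) * κ) = K * (√(max N T : ℝ) * ξ * κ) := by ring
    have e2 : w * (ξ * (2 * l1)) = 2 * (l1 * w * ξ) := by ring
    have e3 : K * w * κ = K * (w * κ) := by ring
    have e4 : (w + √(max N T : ℝ) * ξ) * κ = w * κ + √(max N T : ℝ) * ξ * κ := by ring
    rw [e1, e2, e3, e4]
    linarith [mul_nonneg hK p3]
  -- `errV` contains `λ₁ √T ξ` and `λ_r ≤ λ₁`, so the signal hypothesis itself forces `ξ ≤ 1/32`.
  have hξ_small : ξ ≤ 1 / 4 := by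
    have p1 : 0 ≤ (w + √(max N T : ℝ) * ξ) * κ := by positivity
    have p3 : 0 ≤ l1 * w * ξ := mul_nonneg (mul_nonneg (hlr0.le.trans hl1r) hw0.le) hξ0
    have q1 : 32 * (l1 * w * ξ) ≤ l1 * w := by
      have q := mul_le_mul_of_nonneg_right hl1r hw0.le
      have q' : 8 * 4 * (l1 * w * ξ) ≤ 8 * (4 + K) * err := by
        rw [herr_eq]
        gcongr <;> linarith
      linarith
    have q2 : 0 < l1 * w := mul_pos (hlr0.trans_le hl1r) hw0
    have q3 : l1 * w * ξ ≤ l1 * w * (1 / 4) := by linarith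
    exact le_of_mul_le_mul_left q3 q2
  have hε : ‖M' - M‖ ≤ lr / 8 := by
    have : w * ‖M' - M‖ ≤ w * (lr / 8) := by linarith
    exact le_of_mul_le_mul_left this hw0
  -- The lower bound is `(λ_r / 2)(1 - 1/4) - λ_r / 8 = λ_r / 4`, so there is slack.
  have hshat_low : ∀ i, lr / 8 ≤ shat i := by
    intro i
    have := hex.le_singularValue (by positivity) hY hYYM hlow i
    rw [← hUY, ← hξ] at this
    have q := mul_le_mul_of_nonneg_left hξ_small (half_pos hlr0).le
    linarith
  have hV' := hex.right_orthonormal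
  have hVo := h.right_orthonormal
  have b1 := h.norm_one_sub_proj_mul_le (σ := lr / 2) (by positivity) hs_low hV'
    (hex.one_sub_proj_mul_transpose hUUM')
  have b2 := hex.norm_one_sub_proj_mul_le (σ := lr / 8) (by positivity) hshat_low hVo
    (h.one_sub_proj_mul_transpose hUUM)
  have b3 := norm_proj_sub_proj_le V Vhat
  rw [norm_sub_rev] at b1
  have hd : ‖M' - M‖ ≤ (4 + K) * err / w := by
    rw [le_div_iff₀ hw0]
    linarith
  calc _ ≤ ‖M' - M‖ / (lr / 2) + ‖M' - M‖ / (lr / 8) := b3.trans (add_le_add b1 b2)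
    _ = 10 / lr * ‖M' - M‖ := by field_simp; norm_num
    _ ≤ 12 / lr * ((4 + K) * err / w) := by
        refine mul_le_mul ?_ hd (norm_nonneg _) (by positivity)
        gcongr
        norm_num
    _ = _ := by field_simp

end Deterministic


/-! ### Nets of the Euclidean ball -/

section Net

/-- The closed unit ball of Euclidean space has a `1/2`-net of cardinality at most `5 ^ n`. -/
lemma exists_half_net (n : ℕ) : ∃ s : Finset (EuclideanSpace ℝ (Fin n)), s.card ≤ 5 ^ n ∧
    (∀ x ∈ s, ‖x‖ ≤ 1) ∧ ∀ x, ‖x‖ ≤ 1 → ∃ z ∈ s, ‖x - z‖ ≤ 1 / 2 := by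
  classical
  let P : Finset (EuclideanSpace ℝ (Fin n)) → Prop := fun s =>
    (∀ x ∈ s, ‖x‖ ≤ 1) ∧ ∀ x ∈ s, ∀ y ∈ s, x ≠ y → 1 / 2 ≤ ‖x - y‖
  have hcard : ∀ s, P s → s.card ≤ 5 ^ n := by
    intro s hs
    have hinj : Function.Injective fun x : EuclideanSpace ℝ (Fin n) => (2 : ℝ) • x :=
      smul_right_injective _ two_ne_zero
    -- Doubling turns a `1/2`-separated subset of the unit ball into a `1`-separated subset of the
    -- ball of radius `2`.
    have h := Besicovitch.card_le_of_separated (s.image fun x => (2 : ℝ) • x) ?_ ?_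
    · rwa [Finset.card_image_of_injective _ hinj, finrank_euclideanSpace_fin] at h
    · intro c hc
      obtain ⟨x, hx, rfl⟩ := Finset.mem_image.1 hc
      rw [norm_smul, Real.norm_ofNat]
      linarith [hs.1 x hx]
    · intro c hc d hd hcd
      obtain ⟨x, hx, rfl⟩ := Finset.mem_image.1 hc
      obtain ⟨y, hy, rfl⟩ := Finset.mem_image.1 hd
      have := hs.2 x hx y hy fun h => hcd (by rw [h])
      rw [← smul_sub, norm_smul, Real.norm_ofNat]
      linarith
  -- A separated set of maximal cardinality is a net: an uncovered point could be added to it.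
  let k := Nat.findGreatest (fun k => ∃ s, P s ∧ s.card = k) (5 ^ n)
  obtain ⟨s, hs, hsk⟩ : ∃ s, P s ∧ s.card = k :=
    Nat.findGreatest_spec (P := fun k => ∃ s, P s ∧ s.card = k) (Nat.zero_le _)
      ⟨∅, by simp [P], rfl⟩
  refine ⟨s, hcard s hs, hs.1, fun x hx => ?_⟩
  by_contra! hcon
  have hxs : x ∉ s := fun h => by
    have := hcon x h
    norm_num at this
  have hP : P (insert x s) := by
    refine ⟨?_, ?_⟩
    · intro y hy
      rcases Finset.mem_insert.1 hy with rfl | hy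
      exacts [hx, hs.1 y hy]
    · intro a ha b hb hab
      rcases Finset.mem_insert.1 ha with ha | ha <;> rcases Finset.mem_insert.1 hb with hb | hb
      · exact absurd (ha.trans hb.symm) hab
      · rw [ha]; exact (hcon b hb).le
      · rw [hb, norm_sub_rev]; exact (hcon a ha).le
      · exact hs.2 a ha b hb hab
  have h1 := Nat.le_findGreatest (P := fun k => ∃ s, P s ∧ s.card = k) (hcard _ hP)
    ⟨_, hP, rfl⟩
  rw [Finset.card_insert_of_notMem hxs, hsk] at h1
  exact absurd h1 (by simp [k])

/-- Replacing `v / ‖v‖` by a net point costs at most `‖v‖ / 2`, which is absorbed on the left. -/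
lemma norm_le_of_half_net {n : ℕ} {s : Finset (EuclideanSpace ℝ (Fin n))}
    (hs : ∀ x, ‖x‖ ≤ 1 → ∃ z ∈ s, ‖x - z‖ ≤ 1 / 2) {v : EuclideanSpace ℝ (Fin n)} {b : ℝ}
    (hb : ∀ z ∈ s, inner ℝ z v ≤ b) : ‖v‖ ≤ 2 * b := by
  by_cases hv : v = 0
  · obtain ⟨z, hz, -⟩ := hs 0 (by simp)
    have := hb z hz
    rw [hv, inner_zero_right] at this
    rw [hv, norm_zero]
    linarith
  · obtain ⟨z, hz, hz2⟩ := hs (‖v‖⁻¹ • v) (by simp [norm_smul, hv])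
    have h1 : inner ℝ (‖v‖⁻¹ • v) v = ‖v‖ := by
      rw [real_inner_smul_left, real_inner_self_eq_norm_sq]
      have := norm_ne_zero_iff.2 hv
      field_simp
    have h2 := real_inner_le_norm (‖v‖⁻¹ • v - z) v
    rw [inner_sub_left, h1] at h2
    nlinarith [hb z hz, norm_nonneg v]

/-- Each of the two discretizations, of the left and of the right vector, costs a factor `2`. -/
lemma l2_opNorm_le_of_half_nets {m n : ℕ} {s : Finset (EuclideanSpace ℝ (Fin m))}
    {t : Finset (EuclideanSpace ℝ (Fin n))}
    (hs : ∀ x, ‖x‖ ≤ 1 → ∃ z ∈ s, ‖x - z‖ ≤ 1 / 2)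
    (ht : ∀ x, ‖x‖ ≤ 1 → ∃ z ∈ t, ‖x - z‖ ≤ 1 / 2) {A : Matrix (Fin m) (Fin n) ℝ} {b : ℝ}
    (hb : ∀ x ∈ s, ∀ y ∈ t, x.ofLp ⬝ᵥ A *ᵥ y.ofLp ≤ b) : ‖A‖ ≤ 4 * b := by
  have h1 : ∀ y ∈ t, ‖WithLp.toLp 2 (A *ᵥ y.ofLp)‖ ≤ 2 * b := by
    intro y hy
    refine norm_le_of_half_net hs fun z hz => ?_
    have := hb z hz y hy
    rw [EuclideanSpace.inner_eq_star_dotProduct]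
    simpa [dotProduct_comm] using this
  have hb0 : 0 ≤ b := by
    obtain ⟨y, hy, -⟩ := ht 0 (by simp)
    linarith [h1 y hy, norm_nonneg (WithLp.toLp 2 (A *ᵥ y.ofLp))]
  have h2 : ‖A‖ ≤ 2 * b + ‖A‖ / 2 := by
    conv_lhs => rw [Matrix.l2_opNorm_def]
    refine ContinuousLinearMap.opNorm_le_of_unit_norm (𝕜 := ℝ) (by positivity) fun x hx => ?_
    obtain ⟨z, hz, hz2⟩ := ht x hx.le
    have e : WithLp.toLp 2 (A *ᵥ x.ofLp)
        = WithLp.toLp 2 (A *ᵥ z.ofLp) + WithLp.toLp 2 (A *ᵥ (x - z).ofLp) := by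
      rw [← WithLp.toLp_add, ← Matrix.mulVec_add]
      simp
    change ‖WithLp.toLp 2 (A *ᵥ x.ofLp)‖ ≤ _
    rw [e]
    refine (norm_add_le _ _).trans (add_le_add (h1 z hz) ?_)
    refine (Matrix.l2_opNorm_mulVec A (x - z)).trans ?_
    nlinarith [norm_nonneg A]
  linarith

end Net

/-! ### Gaussian tails for the noise -/

section Tail

variable {Ω : Type*} [MeasurableSpace Ω] {μ : Measure Ω}

/-- Chernoff's bound at the parameter `u / κ`; only an upper bound on the variance is needed, and `v
= 0` is allowed. -/
lemma measureReal_gaussian_ge_le [IsProbabilityMeasure μ] {Z : Ω → ℝ} {v : ℝ≥0}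
    (hZ : HasLaw Z (gaussianReal 0 v) μ) {κ u : ℝ} (hκ : 0 < κ) (hu : 0 ≤ u)
    (hv : (v : ℝ) ≤ κ ^ 2) : μ.real {ω | u * κ ≤ Z ω} ≤ Real.exp (-u ^ 2 / 2) := by
  have hint : Integrable (fun ω => Real.exp (u / κ * Z ω)) μ := by
    have := integrable_exp_mul_gaussianReal (μ := 0) (v := v) (u / κ)
    rw [← hZ.map_eq] at this
    exact this.comp_aemeasurable hZ.aemeasurable
  have h := measure_ge_le_exp_mul_mgf (u * κ) (div_nonneg hu hκ.le) hint
  rw [mgf_gaussianReal hZ.map_eq, ← Real.exp_add] at h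
  refine h.trans (Real.exp_le_exp.2 ?_)
  have e : (u / κ) ^ 2 * κ ^ 2 = u ^ 2 := by field_simp
  have e2 : u / κ * (u * κ) = u ^ 2 := by field_simp
  nlinarith [mul_le_mul_of_nonneg_left hv (sq_nonneg (u / κ))]

variable {N T : ℕ} {E : Ω → Matrix (Fin N) (Fin T) ℝ} {S_C : Matrix (Fin N) (Fin N) ℝ}
  {S_T : Matrix (Fin T) (Fin T) ℝ}

lemma quadForm_le_norm_sqrt_sq {n : ℕ} {S : Matrix (Fin n) (Fin n) ℝ} (hS : S.PosSemidef)
    {x : EuclideanSpace ℝ (Fin n)} (hx : ‖x‖ ≤ 1) :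
    x.ofLp ⬝ᵥ S *ᵥ x.ofLp ≤ ‖CFC.sqrt S‖ ^ 2 := by
  have hsym : (CFC.sqrt S)ᵀ = CFC.sqrt S := by
    have := (CFC.sqrt_nonneg S).isSelfAdjoint.star_eq
    rwa [Matrix.star_eq_conjTranspose, Matrix.conjTranspose_eq_transpose_of_trivial] at this
  have e : x.ofLp ⬝ᵥ S *ᵥ x.ofLp = ‖WithLp.toLp 2 (CFC.sqrt S *ᵥ x.ofLp)‖ ^ 2 := by
    rw [EuclideanSpace.real_norm_sq_eq]
    conv_lhs => rw [← CFC.sqrt_mul_sqrt_self S hS.nonneg]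
    rw [← Matrix.mulVec_mulVec, Matrix.dotProduct_mulVec, ← Matrix.mulVec_transpose, hsym]
    simp [dotProduct, sq]
  rw [e]
  have := Matrix.l2_opNorm_mulVec (CFC.sqrt S) x
  refine pow_le_pow_left₀ (norm_nonneg _) (this.trans ?_) 2
  exact mul_le_of_le_one_right (norm_nonneg _) hx

/-- The bilinear form is the inner product of the noise with the tensor `x ⊗ y`, on which the
Kronecker covariance factorizes. -/
lemma SeparableGaussian.bilinear_hasLaw (hE : SeparableGaussian μ E S_C S_T)
    (hC : S_C.PosSemidef) (hT : S_T.PosSemidef) (x : Fin N → ℝ) (y : Fin T → ℝ) :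
    HasLaw (fun ω => x ⬝ᵥ E ω *ᵥ y)
      (gaussianReal 0 ((x ⬝ᵥ S_C *ᵥ x) * (y ⬝ᵥ S_T *ᵥ y)).toNNReal) μ := by
  set w : EuclideanSpace ℝ (Fin N × Fin T) := WithLp.toLp 2 fun p => x p.1 * y p.2 with hw
  have hS := hC.kronecker hT
  have hlaw : HasLaw (innerSL ℝ w) (gaussianReal 0 ((x ⬝ᵥ S_C *ᵥ x) * (y ⬝ᵥ S_T *ᵥ y)).toNNReal)
      (multivariateGaussian 0 (S_C ⊗ₖ S_T)) := by
    refine ⟨(innerSL ℝ w).continuous.aemeasurable, ?_⟩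
    rw [IsGaussian.map_eq_gaussianReal]
    congr 1
    · rw [(innerSL ℝ w).integral_comp_id_comm IsGaussian.integrable_id,
        integral_id_multivariateGaussian, map_zero]
    · congr 1
      have h1 := covarianceBilin_self (μ := multivariateGaussian 0 (S_C ⊗ₖ S_T))
        IsGaussian.memLp_two_id w
      rw [covarianceBilin_multivariateGaussian hS] at h1
      change Var[fun u => inner ℝ w u; _] = _
      rw [← h1]
      simp only [dotProduct, Matrix.mulVec, Fintype.sum_prod_type, Matrix.kroneckerMap_apply, hw]
      rw [Finset.sum_mul_sum]
      refine Finset.sum_congr rfl fun i _ => Finset.sum_congr rfl fun t _ => ?_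
      rw [mul_mul_mul_comm, Finset.sum_mul_sum]
      refine congrArg _ (Finset.sum_congr rfl fun j _ => Finset.sum_congr rfl fun s _ => ?_)
      ring
  have h2 := hlaw.comp hE
  refine h2.congr (Filter.Eventually.of_forall fun ω => ?_)
  simp only [Function.comp_apply, innerSL_apply_apply, PiLp.inner_apply, hw,
    Fintype.sum_prod_type, dotProduct, Matrix.mulVec, Finset.mul_sum]
  refine Finset.sum_congr rfl fun i _ => Finset.sum_congr rfl fun t _ => ?_
  simp only [RCLike.inner_apply, conj_trivial]
  ring

/-- A net argument for the spectral norm of a compression of separable Gaussian noise. -/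
lemma SeparableGaussian.measureReal_norm_gt_le [IsProbabilityMeasure μ]
    (hE : SeparableGaussian μ E S_C S_T)
    (hC : S_C.PosSemidef) (hT : S_T.PosSemidef) (hκ : 0 < ‖CFC.sqrt S_T‖ * ‖CFC.sqrt S_C‖)
    {m : ℕ} {B : Matrix (Fin N) (Fin m) ℝ} (hB : ‖B‖ ≤ 1) {u : ℝ} (hu : 0 ≤ u) :
    μ.real {ω | 4 * u * (‖CFC.sqrt S_T‖ * ‖CFC.sqrt S_C‖) < ‖Bᵀ * E ω‖}
      ≤ 5 ^ (m + T) * Real.exp (-u ^ 2 / 2) := by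
  set κ := ‖CFC.sqrt S_T‖ * ‖CFC.sqrt S_C‖
  obtain ⟨s, hs, hs1, hs2⟩ := exists_half_net m
  obtain ⟨t, ht, ht1, ht2⟩ := exists_half_net T
  have hsub : {ω | 4 * u * κ < ‖Bᵀ * E ω‖} ⊆
      ⋃ p ∈ s ×ˢ t, {ω | u * κ ≤ (B *ᵥ p.1.ofLp) ⬝ᵥ E ω *ᵥ p.2.ofLp} := by
    intro ω hω
    by_contra hcon
    simp only [Set.mem_iUnion, not_exists, Set.mem_ofPred_eq, not_le] at hcon
    have := l2_opNorm_le_of_half_nets hs2 ht2 (A := Bᵀ * E ω) (b := u * κ) fun x hx y hy => by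
      -- Moving `B` to the left vector, `x ⬝ᵥ Bᵀ E y = (B x) ⬝ᵥ E y`, leaves a bilinear form in `E`;
      -- the union bound thus runs over a net in dimension `m`, not `N`.
      have h := (hcon (x, y) (Finset.mk_mem_product hx hy)).le
      rw [← Matrix.mulVec_mulVec, Matrix.dotProduct_mulVec, ← Matrix.mulVec_transpose,
        Matrix.transpose_transpose]
      exact h
    rw [Set.mem_ofPred_eq] at hω
    linarith
  refine (measureReal_mono hsub (measure_ne_top _ _)).trans ((measureReal_biUnion_finset_le _ _).trans ?_)
  have hp : ∀ p ∈ s ×ˢ t, μ.real {ω | u * κ ≤ (B *ᵥ p.1.ofLp) ⬝ᵥ E ω *ᵥ p.2.ofLp}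
      ≤ Real.exp (-u ^ 2 / 2) := by
    intro p hp
    obtain ⟨hp1, hp2⟩ := Finset.mem_product.1 hp
    refine measureReal_gaussian_ge_le (hE.bilinear_hasLaw hC hT _ _) hκ hu ?_
    rw [Real.coe_toNNReal']
    refine max_le ?_ (sq_nonneg _)
    have hx : ‖WithLp.toLp 2 (B *ᵥ p.1.ofLp)‖ ≤ 1 :=
      (Matrix.l2_opNorm_mulVec B p.1).trans (mul_le_one₀ hB (norm_nonneg _) (hs1 _ hp1))
    have h1 := quadForm_le_norm_sqrt_sq hC hx
    have h2 := quadForm_le_norm_sqrt_sq hT (ht1 _ hp2)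
    rw [mul_pow, mul_comm]
    refine mul_le_mul h2 h1 ?_ (sq_nonneg _)
    simpa using hC.dotProduct_mulVec_nonneg (B *ᵥ p.1.ofLp)
  refine (Finset.sum_le_sum hp).trans ?_
  rw [Finset.sum_const, nsmul_eq_mul, Finset.card_product, pow_add]
  refine mul_le_mul_of_nonneg_right ?_ (Real.exp_nonneg _)
  push_cast
  exact mul_le_mul (by exact_mod_cast hs) (by exact_mod_cast ht) (by positivity) (by positivity)

end Tail


/-! ### Almost sure full rank of the data matrix -/

section FullRank

lemma pi_absolutelyContinuous {μ ν : Measure ℝ} [SigmaFinite μ] [SigmaFinite ν] (h : μ ≪ ν) :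
    ∀ n : ℕ, Measure.pi (fun _ : Fin n => μ) ≪ Measure.pi (fun _ : Fin n => ν)
  | 0 => by rw [Measure.pi_of_empty, Measure.pi_of_empty]
  | n + 1 => by
    have h1 := (measurePreserving_piFinSuccAbove (fun _ : Fin (n + 1) => μ) 0).symm.map_eq
    have h2 := (measurePreserving_piFinSuccAbove (fun _ : Fin (n + 1) => ν) 0).symm.map_eq
    rw [← h1, ← h2]
    exact (h.prod (pi_absolutelyContinuous h n)).map (MeasurableEquiv.measurable _)

variable {ι : Type*} [Fintype ι]

lemma stdGaussian_absolutelyContinuous :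
    stdGaussian (EuclideanSpace ℝ ι) ≪ (volume : Measure (EuclideanSpace ℝ ι)) := by
  set b := stdOrthonormalBasis ℝ (EuclideanSpace ℝ ι)
  have hmp := b.measurePreserving_repr_symm.comp
    (PiLp.volume_preserving_toLp (Fin (Module.finrank ℝ (EuclideanSpace ℝ ι))))
  have e : (fun x : Fin (Module.finrank ℝ (EuclideanSpace ℝ ι)) → ℝ => ∑ i, x i • b i)
      = b.repr.symm ∘ WithLp.toLp 2 := by
    ext1 x
    simp [← b.sum_repr_symm]
  rw [stdGaussian, e, ← hmp.map_eq]
  exact (pi_absolutelyContinuous (gaussianReal_absolutelyContinuous 0 one_ne_zero) _).map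
    hmp.measurable

variable [DecidableEq ι]

/-- The law is the image of the standard Gaussian under the invertible map `√S`, which only rescales
Lebesgue measure. -/
lemma multivariateGaussian_absolutelyContinuous {S : Matrix ι ι ℝ} (hS : S.PosDef) :
    multivariateGaussian 0 S ≪ (volume : Measure (EuclideanSpace ℝ ι)) := by
  set f := Matrix.toEuclideanCLM (n := ι) (𝕜 := ℝ) (CFC.sqrt S)
  have hsqrt : IsUnit (CFC.sqrt S) := by
    have h := hS.isUnit
    rw [Matrix.isUnit_iff_isUnit_det, ← CFC.sqrt_mul_sqrt_self S hS.posSemidef.nonneg,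
      Matrix.det_mul] at h
    rw [Matrix.isUnit_iff_isUnit_det]
    exact isUnit_of_mul_isUnit_left h
  have hdet : LinearMap.det (f : EuclideanSpace ℝ ι →ₗ[ℝ] EuclideanSpace ℝ ι) ≠ 0 := by
    have h1 : IsUnit f := hsqrt.map (Matrix.toEuclideanCLM (n := ι) (𝕜 := ℝ))
    have h2 := h1.map (ContinuousLinearMap.toLinearMapRingHom (R₁ := ℝ) (M₁ := EuclideanSpace ℝ ι))
    exact ((LinearMap.isUnit_iff_isUnit_det _).1 h2).ne_zero
  have hmap := Measure.map_linearMap_addHaar_eq_smul_addHaar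
    (volume : Measure (EuclideanSpace ℝ ι)) hdet
  rw [multivariateGaussian]
  simp only [zero_add]
  refine (stdGaussian_absolutelyContinuous.map f.continuous.measurable).trans ?_
  change Measure.map (f : EuclideanSpace ℝ ι →ₗ[ℝ] EuclideanSpace ℝ ι) volume ≪ volume
  rw [hmap]
  exact Measure.smul_absolutelyContinuous

variable {N T k : ℕ}

/-- A fixed square block of `M + G` is almost surely invertible when `G` has a density. -/
lemma ae_det_submatrix_ne_zero {ν : Measure (EuclideanSpace ℝ (Fin N × Fin T))}
    (hν : ν ≪ volume) (M : Matrix (Fin N) (Fin T) ℝ) {e : Fin k → Fin N} {e' : Fin k → Fin T}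
    (he : Function.Injective e) (he' : Function.Injective e') :
    ∀ᵐ g ∂ν, ((M + Matrix.of fun i t => g (i, t)).submatrix e e').det ≠ 0 := by
  classical
  refine hν.ae_le ?_
  -- `B` has the identity in the chosen block. Along each line `y + x B` the block is `x • 1 - A`,
  -- whose determinant is the characteristic polynomial of `A` at `x`, with finitely many zeros;
  -- being null on every such line makes the exceptional set null.
  set B : EuclideanSpace ℝ (Fin N × Fin T) :=
    WithLp.toLp 2 fun p => if ∃ a, p.1 = e a ∧ p.2 = e' a then 1 else 0 with hB
  have hcont : Continuous fun g : EuclideanSpace ℝ (Fin N × Fin T) =>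
      ((M + Matrix.of fun i t => g (i, t)).submatrix e e').det := by
    refine Continuous.matrix_det ?_
    refine continuous_matrix fun a b => ?_
    simp only [Matrix.submatrix_apply, Matrix.add_apply, Matrix.of_apply]
    fun_prop
  refine ae_mem_of_ae_add_linearMap_mem (LinearMap.toSpanSingleton ℝ _ B) volume volume
    (s := {g | ((M + Matrix.of fun i t => g (i, t)).submatrix e e').det ≠ 0})
    (hcont.measurable (measurableSet_singleton 0).compl) fun y => ?_
  set A := -(M + Matrix.of fun i t => y (i, t)).submatrix e e' with hA
  have hfin : {x : ℝ | A.charpoly.eval x = 0}.Finite :=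
    (A.charpoly.roots.toFinset.finite_toSet).subset fun x hx => by
      simpa [A.charpoly_monic.ne_zero] using hx
  have h0 : volume {x : ℝ | A.charpoly.eval x = 0} = 0 := hfin.measure_zero _
  refine measure_mono_null (fun x hx => ?_) h0
  simp only [Set.mem_compl_iff, Set.mem_ofPred_eq, not_not, LinearMap.toSpanSingleton_apply] at hx ⊢
  rw [Matrix.eval_charpoly, ← hx]
  congr 1
  ext a b
  have hab : (∃ c, e a = e c ∧ e' b = e' c) ↔ a = b := by
    constructor
    · rintro ⟨c, h1, h2⟩
      rw [he h1, he' h2]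
    · rintro rfl
      exact ⟨a, rfl, rfl⟩
  simp [hA, hB, Matrix.scalar_apply, Matrix.diagonal_apply, hab]
  ring

variable {Ω : Type*} [MeasurableSpace Ω] {μ : Measure Ω} [IsProbabilityMeasure μ] {r : ℕ}
  {L : Matrix (Fin N) (Fin r) ℝ} {lam : Fin r → ℝ} {F : Ω → Matrix (Fin T) (Fin r) ℝ}
  {E : Ω → Matrix (Fin N) (Fin T) ℝ} {δ η : ℝ} {S_C : Matrix (Fin N) (Fin N) ℝ}
  {S_T : Matrix (Fin T) (Fin T) ℝ}

/-- By independence and Fubini the factors can be frozen; `L Fᵀ` is then a deterministic shift of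
the noise. -/
lemma FactorAssumption.ae_det_submatrix_ne_zero (h : FactorAssumption μ L lam F E δ η)
    (hE : SeparableGaussian μ E S_C S_T) (hC : S_C.PosDef) (hT : S_T.PosDef)
    {e : Fin k → Fin N} {e' : Fin k → Fin T} (he : Function.Injective e)
    (he' : Function.Injective e') :
    ∀ᵐ ω ∂μ, ((dataMatrix L (F ω) (E ω)).submatrix e e').det ≠ 0 := by
  set f : Ω → Fin T × Fin r → ℝ := fun ω p => F ω p.1 p.2
  set g : Ω → EuclideanSpace ℝ (Fin N × Fin T) := fun ω => WithLp.toLp 2 fun p => E ω p.1 p.2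
  have hf : Measurable f := measurable_pi_lambda _ fun p => h.measurable_factor p.1 p.2
  have hg0 : Measurable fun ω (p : Fin N × Fin T) => E ω p.1 p.2 :=
    measurable_pi_lambda _ fun p => h.measurable_noise p.1 p.2
  have htoLp : Measurable (WithLp.toLp 2 : (Fin N × Fin T → ℝ) → EuclideanSpace ℝ (Fin N × Fin T)) :=
    by fun_prop
  have hg : Measurable g := htoLp.comp hg0
  have hind : IndepFun f g μ := h.indep.comp measurable_id htoLp
  have hprod := (indepFun_iff_map_prod_eq_prod_map_map hf.aemeasurable hg.aemeasurable).1 hind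
  let s : Set ((Fin T × Fin r → ℝ) × EuclideanSpace ℝ (Fin N × Fin T)) :=
    {q | ((L * (Matrix.of fun t j => q.1 (t, j))ᵀ + Matrix.of fun i t => q.2 (i, t)).submatrix
      e e').det ≠ 0}
  have hcont : Continuous fun q : (Fin T × Fin r → ℝ) × EuclideanSpace ℝ (Fin N × Fin T) =>
      ((L * (Matrix.of fun t j => q.1 (t, j))ᵀ + Matrix.of fun i t => q.2 (i, t)).submatrix
      e e').det := by
    refine Continuous.matrix_det (continuous_matrix fun a b => ?_)
    simp only [Matrix.submatrix_apply, Matrix.add_apply, Matrix.of_apply, Matrix.mul_apply,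
      Matrix.transpose_apply]
    fun_prop
  have hs : MeasurableSet s := hcont.measurable (measurableSet_singleton 0).compl
  have hae : ∀ᵐ q ∂(μ.map fun ω => (f ω, g ω)), q ∈ s := by
    have := Measure.isProbabilityMeasure_map (μ := μ) hg.aemeasurable
    have := Measure.isProbabilityMeasure_map (μ := μ) hf.aemeasurable
    rw [hprod, Measure.ae_prod_mem_iff_ae_ae_mem hs]
    refine Filter.Eventually.of_forall fun a => ?_
    have hlaw : μ.map g = multivariateGaussian 0 (S_C ⊗ₖ S_T) := HasLaw.map_eq hE
    rw [hlaw]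
    have key := WPCA.ae_det_submatrix_ne_zero
      (multivariateGaussian_absolutelyContinuous (hC.kronecker hT))
      (L * (Matrix.of fun t j => a (t, j))ᵀ) he he'
    filter_upwards [key] with y hy using hy
  filter_upwards [ae_of_ae_map (hf.prodMk hg).aemeasurable hae] with ω hω
  exact hω

lemma FactorAssumption.ae_full_rank (h : FactorAssumption μ L lam F E δ η)
    (hE : SeparableGaussian μ E S_C S_T) (hC : S_C.PosDef) (hT : S_T.PosDef) :
    ∀ᵐ ω ∂μ, (∃ W : Matrix (Fin T) (Fin N) ℝ, dataMatrix L (F ω) (E ω) * W = 1) ∨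
      ∃ W : Matrix (Fin T) (Fin N) ℝ, W * dataMatrix L (F ω) (E ω) = 1 := by
  rcases le_total N T with hNT | hTN
  · filter_upwards [h.ae_det_submatrix_ne_zero hE hC hT Function.injective_id
      (Fin.castLE_injective hNT)] with ω hω
    left
    set X := dataMatrix L (F ω) (E ω)
    have e : X * (1 : Matrix (Fin T) (Fin T) ℝ).submatrix id (Fin.castLE hNT)
        = X.submatrix id (Fin.castLE hNT) := by
      ext i t
      simp [Matrix.mul_apply, Matrix.one_apply]
    refine ⟨(1 : Matrix (Fin T) (Fin T) ℝ).submatrix id (Fin.castLE hNT) *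
      (X.submatrix id (Fin.castLE hNT))⁻¹, ?_⟩
    rw [← Matrix.mul_assoc, e, Matrix.mul_nonsing_inv _ (isUnit_iff_ne_zero.2 hω)]
  · filter_upwards [h.ae_det_submatrix_ne_zero hE hC hT (Fin.castLE_injective hTN)
      Function.injective_id] with ω hω
    right
    set X := dataMatrix L (F ω) (E ω)
    have e : (1 : Matrix (Fin N) (Fin N) ℝ).submatrix (Fin.castLE hTN) id * X
        = X.submatrix (Fin.castLE hTN) id := by
      ext i t
      simp [Matrix.mul_apply, Matrix.one_apply]
    refine ⟨(X.submatrix (Fin.castLE hTN) id)⁻¹ *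
      (1 : Matrix (Fin N) (Fin N) ℝ).submatrix (Fin.castLE hTN) id, ?_⟩
    rw [Matrix.mul_assoc, e, Matrix.nonsing_inv_mul _ (isUnit_iff_ne_zero.2 hω)]

end FullRank


/-! ### Choice of constants and the good event -/

lemma le_of_orthonormal {n r : ℕ} {V : Matrix (Fin n) (Fin r) ℝ} (hV : Vᵀ * V = 1) : r ≤ n := by
  have h1 := Matrix.rank_mul_le_right Vᵀ V
  rw [hV, Matrix.rank_one, Fintype.card_fin] at h1
  simpa using h1.trans (Matrix.rank_le_card_height V)

lemma norm_sqrt_pos {n : ℕ} (hn : 0 < n) {S : Matrix (Fin n) (Fin n) ℝ} (hS : S.PosDef) :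
    0 < ‖CFC.sqrt S‖ := by
  have : Nonempty (Fin n) := ⟨⟨0, hn⟩⟩
  refine norm_pos_iff.2 fun h => hS.isUnit.ne_zero ?_
  rw [← CFC.sqrt_mul_sqrt_self S hS.posSemidef.nonneg, h, mul_zero]

lemma five_pow_mul_exp_le {m : ℕ} {x c : ℝ} (hm : (m : ℝ) ≤ 2 * x) :
    5 ^ m * Real.exp (-((2 * Real.log 5 + c) * x)) ≤ Real.exp (-(c * x)) := by
  have h5 : (5 : ℝ) ^ m = Real.exp (m * Real.log 5) := by
    rw [Real.exp_nat_mul, Real.exp_log (by norm_num)]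
  rw [h5, ← Real.exp_add]
  refine Real.exp_le_exp.2 ?_
  have : 0 ≤ Real.log 5 := Real.log_nonneg (by norm_num)
  nlinarith [mul_le_mul_of_nonneg_right hm this]

lemma exp_neg_le_zpow {n x : ℝ} (hn : 0 < n) (h : Real.log n ≤ x) :
    Real.exp (-(9 * x)) ≤ n ^ (-9 : ℤ) := by
  have e : n ^ (-9 : ℤ) = Real.exp (-(9 * Real.log n)) := by
    rw [Real.exp_neg, zpow_neg]
    congr 1
    have := Real.exp_nat_mul (Real.log n) 9
    rw [Real.exp_log hn] at this
    exact_mod_cast this.symm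
  rw [e]
  exact Real.exp_le_exp.2 (by linarith)

/-- The complement of a measurable hull of the bad set works, so measurability of the bad set need
not be checked. -/
lemma exists_measurable_good {Ω : Type*} [MeasurableSpace Ω] {μ : Measure Ω}
    [IsProbabilityMeasure μ] {bad : Set Ω} {p : ℝ} (hp : μ.real bad ≤ p) :
    ∃ good : Set Ω, MeasurableSet good ∧ 1 - p ≤ μ.real good ∧ ∀ ω ∈ good, ω ∉ bad := by
  refine ⟨(toMeasurable μ bad)ᶜ, (measurableSet_toMeasurable _ _).compl, ?_,
    fun ω hω hb => hω (subset_toMeasurable _ _ hb)⟩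
  rw [probReal_compl_eq_one_sub (measurableSet_toMeasurable _ _), measureReal_def,
    measure_toMeasurable, ← measureReal_def]
  linarith

end WPCA

theorem theorem2p3 (A c : ℝ) (hA : 0 < A) (hc : 0 < c) :
    ∃ c₀ C₀ C₁ C₂ : ℝ, 0 < c₀ ∧ 0 < C₀ ∧ 0 < C₁ ∧ 0 < C₂ ∧
      ∀ (Ω : Type*) [MeasurableSpace Ω] (μ : Measure Ω) [IsProbabilityMeasure μ]
        (N T r : ℕ) (hr : 0 < r)
        (L : Matrix (Fin N) (Fin r) ℝ) (lam : Fin r → ℝ)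
        (F : Ω → Matrix (Fin T) (Fin r) ℝ) (E : Ω → Matrix (Fin N) (Fin T) ℝ)
        (S_C : Matrix (Fin N) (Fin N) ℝ) (S_T : Matrix (Fin T) (Fin T) ℝ)
        (Q : Matrix (Fin T) (Fin T) ℝ) (δ η : ℝ),
        δ ≤ 1 / 2 →
        WPCA.FactorAssumption μ L lam F E δ η →
        S_C.PosDef → S_T.PosDef →
        WPCA.SeparableGaussian μ E S_C S_T →
        Q.IsSymm → r ≤ Q.rank →
        (T : ℝ) ≤ A * Real.exp (c * N) →
        Real.log (max N T : ℝ) ≤ A * T →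
        ∃ good : Set Ω, MeasurableSet good ∧
          1 - η - C₂ * (Real.exp (-c₀ * N) + (max N T : ℝ) ^ (-9 : ℤ)) ≤ μ.real good ∧
          ∀ ω ∈ good,
            ∀ (U : Matrix (Fin N) (Fin r) ℝ) (s : Fin r → ℝ) (V : Matrix (Fin T) (Fin r) ℝ)
              (Uhat : Matrix (Fin N) (Fin r) ℝ) (shat : Fin r → ℝ)
              (Vhat : Matrix (Fin T) (Fin r) ℝ),
              WPCA.IsTruncSVD ((√(T : ℝ))⁻¹ • (L * (F ω)ᵀ)) U s V →
              WPCA.IsWeightedPCA (WPCA.dataMatrix L (F ω) (E ω)) Q Uhat shat Vhat →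
              C₀ * WPCA.errV (lam ⟨0, hr⟩) S_C S_T ‖Uhat * Uhatᵀ - U * Uᵀ‖
                  ≤ lam ⟨r - 1, Nat.sub_lt hr one_pos⟩ * √(T : ℝ) →
              ‖Vhat * Vhatᵀ - V * Vᵀ‖
                ≤ C₁ * (WPCA.errV (lam ⟨0, hr⟩) S_C S_T ‖Uhat * Uhatᵀ - U * Uᵀ‖
                  / (lam ⟨r - 1, Nat.sub_lt hr one_pos⟩ * √(T : ℝ))) := by
  have hlog5 : 0 < Real.log 5 := Real.log_pos (by norm_num)
  -- `2 log 5` pays for the nets, `1` yields `e^{-N}`, and `9 A` with `log n ≤ A T` yields `n^{-9}`.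
  -- In `K`, the `4` is the loss from the nets and `√(2B)` makes the Gaussian exponent equal to `-B
  -- x` at level `x`.
  set B := 2 * Real.log 5 + (1 + 9 * A) with hB
  have hB0 : 0 < B := by positivity
  set K := 4 * √(2 * B) with hK
  have hK0 : 0 ≤ K := by positivity
  refine ⟨1, 8 * (4 + K), 12 * (4 + K), 1, one_pos, by positivity, by positivity, one_pos, ?_⟩
  intro Ω _ μ _ N T r hr L lam F E S_C S_T Q δ η hδ hfac hC hT hgauss _ hQ _ hlog
  -- Otherwise no rank-`r` truncated SVD exists and the whole space is a good event.
  by_cases hdim : r ≤ N ∧ r ≤ T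
  swap
  · refine ⟨Set.univ, MeasurableSet.univ, ?_, fun ω _ U s V _ _ _ h _ _ =>
      absurd ⟨WPCA.le_of_orthonormal h.left_orthonormal,
        WPCA.le_of_orthonormal h.right_orthonormal⟩ hdim⟩
    have hη : 0 ≤ η := measureReal_nonneg.trans hfac.concentration
    have h1 : 0 ≤ (max N T : ℝ) ^ (-9 : ℤ) := zpow_nonneg (by positivity) _
    have h2 := Real.exp_nonneg (-1 * (N : ℝ))
    rw [probReal_univ]
    linarith
  obtain ⟨hrN, hrT⟩ := hdim
  have hN0 : 0 < N := hr.trans_le hrN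
  have hT0 : 0 < T := hr.trans_le hrT
  set n : ℝ := max N T with hn
  have hNn : (N : ℝ) ≤ n := le_max_left _ _
  have hTn : (T : ℝ) ≤ n := le_max_right _ _
  have hn0 : 0 < n := lt_of_lt_of_le (by exact_mod_cast hN0) hNn
  set κ := ‖CFC.sqrt S_T‖ * ‖CFC.sqrt S_C‖ with hκ
  have hκ0 : 0 < κ := mul_pos (WPCA.norm_sqrt_pos hT0 hT) (WPCA.norm_sqrt_pos hN0 hC)
  have hY := WPCA.normalizedLoading_orthonormal hfac.loading hfac.lam_pos
  set Y := WPCA.normalizedLoading L lam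
  have hexp : ∀ x : ℝ, 0 ≤ x → -√(2 * B * x) ^ 2 / 2 = -(B * x) := fun x hx => by
    rw [Real.sq_sqrt (by positivity)]
    ring
  have hscale : ∀ x : ℝ, 4 * √(2 * B * x) = K * √x := fun x => by
    rw [hK, Real.sqrt_mul (by positivity)]
    ring
  -- The full noise is controlled at level `n`, as `N + T ≤ 2n`; its compression by `Y` already at
  -- level `T`, as `r + T ≤ 2T`.
  have b1 := hgauss.measureReal_norm_gt_le hC.posSemidef hT.posSemidef hκ0
    (B := 1) WPCA.l2_opNorm_one_le (Real.sqrt_nonneg (2 * B * n))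
  have b2 := hgauss.measureReal_norm_gt_le hC.posSemidef hT.posSemidef hκ0
    (B := Y) (WPCA.l2_opNorm_le_one_of_orthonormal hY) (Real.sqrt_nonneg (2 * B * T))
  rw [hexp _ hn0.le, hscale] at b1
  rw [hexp _ (Nat.cast_nonneg T), hscale] at b2
  simp only [Matrix.transpose_one, Matrix.one_mul] at b1
  have b1' : 5 ^ (N + T) * Real.exp (-(B * n)) ≤ Real.exp (-1 * N) := by
    refine (WPCA.five_pow_mul_exp_le (by push_cast; linarith)).trans (Real.exp_le_exp.2 ?_)
    nlinarith [mul_pos hA hn0]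
  have b2' : 5 ^ (r + T) * Real.exp (-(B * T)) ≤ n ^ (-9 : ℤ) := by
    have hrT' : (r : ℝ) ≤ T := by exact_mod_cast hrT
    refine (WPCA.five_pow_mul_exp_le (by push_cast; linarith)).trans
      (le_trans (Real.exp_le_exp.2 ?_) (WPCA.exp_neg_le_zpow hn0 hlog))
    have : (0 : ℝ) ≤ T := Nat.cast_nonneg T
    linarith
  have b3 := hfac.ae_full_rank hgauss hC hT
  rw [ae_iff] at b3
  set s1 := {ω | K * √n * κ < ‖E ω‖}
  set s2 := {ω | K * √(T : ℝ) * κ < ‖Yᵀ * E ω‖}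
  set s3 := {ω | δ ≤ ‖(T : ℝ)⁻¹ • ((F ω)ᵀ * F ω) - 1‖}
  set s4 := {ω | ¬((∃ W : Matrix (Fin T) (Fin N) ℝ, WPCA.dataMatrix L (F ω) (E ω) * W = 1) ∨
      ∃ W : Matrix (Fin T) (Fin N) ℝ, W * WPCA.dataMatrix L (F ω) (E ω) = 1)}
  have hbad : μ.real (s1 ∪ s2 ∪ s3 ∪ s4) ≤ η + (Real.exp (-1 * N) + n ^ (-9 : ℤ)) := by
    have u1 := measureReal_union_le (μ := μ) s1 s2
    have u2 := measureReal_union_le (μ := μ) (s1 ∪ s2) s3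
    have u3 := measureReal_union_le (μ := μ) (s1 ∪ s2 ∪ s3) s4
    have u4 : μ.real s4 = 0 := by rw [measureReal_def, b3, ENNReal.toReal_zero]
    have u5 : μ.real s3 ≤ η := hfac.concentration
    linarith
  obtain ⟨good, hgood, hprob, hnot⟩ := WPCA.exists_measurable_good hbad
  refine ⟨good, hgood, by linarith, fun ω hω U s V Uhat shat Vhat hU hhat herr => ?_⟩
  have hω' := hnot ω hω
  simp only [Set.mem_union, not_or, s1, s2, s3, s4, Set.mem_ofPred_eq, not_lt, not_le] at hω'
  obtain ⟨⟨⟨h1, h2⟩, h3⟩, h4⟩ := hω'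
  exact WPCA.right_subspace_bound hr hT0 hfac.loading hfac.lam_antitone hfac.lam_pos
    (h3.le.trans hδ) hK0 h1 h2 hQ (by tauto) hU hhat herr
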